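/- Let $X$ be a complex Hilbert space and let $T$ be a bounded linear operator on $X$ which is power-bounded, i.e. $\sup_{n\ge0}\|T^n\|<\infty$, and satisfies $\sigma(T)\cap\mathbb{T}=\{1\}$, where $\mathbb{T}=\{\lambda\in\mathbb{C}:|\lambda|=1\}$. Let $m\colon(0,\pi]\to(0,\infty)$ be a continuous non-increasing function which has reciprocally positive increase, i.e. there exist constants $c\in(0,1]$, $\alpha>0$ and $\varepsilon_0\in(0,\pi]$ such that $$\frac{m(t^{-1}\varepsilon)}{m(\varepsilon)}\ge c\,t^{\alpha},\qquad t\ge1,\ 0<\varepsilon\le\varepsilon_0 .$$ Suppose that the resolvent $R(\lambda,T)=(\lambda I-T)^{-1}$ satisfies $\|R(e^{i\theta},T)\|\le m(|\theta|)$ for all real $\theta$ with $0<|\theta|\le\pi$. Then $$\|T^n(I-T)\|=O\big(m^{-1}(n)\big),\qquad n\to\infty,$$ where $m^{-1}(s)=\inf\{\varepsilon\in(0,\pi]: m(\varepsilon)\le s\}$ for $s\ge m(\pi)$. -/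

import Mathlib

/-- A bounded operator `T` is power-bounded if `sup_{n ≥ 0} ‖T ^ n‖ < ∞`. -/
def IsPowerBounded {X : Type*} [NormedAddCommGroup X] [NormedSpace ℂ X] (T : X →L[ℂ] X) : Prop :=
  ∃ K : ℝ, ∀ n : ℕ, ‖T ^ n‖ ≤ K

/-- A function `m : (0, π] → (0, ∞)` (only the values of `m` on `(0, π]` matter) has reciprocally
positive increase if `m (t⁻¹ ε) / m ε ≥ c t ^ α` for all `t ≥ 1` and `0 < ε ≤ ε₀`, for some
constants `c ∈ (0, 1]`, `α > 0` and `ε₀ ∈ (0, π]`. -/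
def HasReciprocallyPositiveIncrease (m : ℝ → ℝ) : Prop :=
  ∃ c ∈ Set.Ioc (0 : ℝ) 1, ∃ α : ℝ, 0 < α ∧ ∃ ε₀ ∈ Set.Ioc (0 : ℝ) Real.pi,
    ∀ t : ℝ, 1 ≤ t → ∀ ε ∈ Set.Ioc (0 : ℝ) ε₀, c * t ^ α ≤ m (t⁻¹ * ε) / m ε

/-- The right-inverse `m⁻¹ (s) = inf {ε ∈ (0, π] : m ε ≤ s}` of a non-increasing function `m` on
`(0, π]` that blows up at `0`. It is meaningful for `s ≥ m π`, when the set is non-empty. -/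
noncomputable def rightInv (m : ℝ → ℝ) (s : ℝ) : ℝ :=
  sInf {ε : ℝ | ε ∈ Set.Ioc (0 : ℝ) Real.pi ∧ m ε ≤ s}

/-!
Let `K` bound the powers of `T`, let `ε = m⁻¹(n)`, and for `|z| = 1` let
`B(z) = ∑_{i < M} (z T)^i`, where `M` is comparable to `n`. The proof compares `T ^ n (1 - T)` with
the average of `T ^ k (1 - T)` with weights `χ k`, the coefficients of
`(1 + X + ⋯ + X ^ (M - 1)) ^ (j + 2)`: the transform of `χ k • T ^ k (1 - T) x` at `z` is
`(1 - T) B(z) ^ (j + 1) (B(z) x)`.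

The kernel satisfies `‖(1 - T) B(z) ^ (j + 1)‖ ≤ G ε M ^ (j + 1)` uniformly in `z`
(`norm_one_sub_mul_geom_sum_pow_le`). Indeed `z (1 - T) = (1 - z T) - (1 - z)`. The first summand
telescopes against one factor `B(z)`, and the gain `1 / M` is at most a multiple of `ε`, because
`1 ∈ σ(T)` forces `1 ≤ ε m(ε)` (`one_le_mul_norm_resolvent`). For the second summand, write
`z = exp (-i θ)`, so that `|1 - z| ≤ |θ|`. If `|θ| ≤ ε`, the trivial bound `‖B(z)‖ ≤ M K` is enough.
If `|θ| ≥ ε`, then `B(z) = (1 - z T)⁻¹ (1 - (z T) ^ M)` gives `‖B(z)‖ ≤ 2 K m(|θ|)`, and for `j`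
large, reciprocally positive increase bounds `|θ| m(|θ|) ^ (j + 1)` by a multiple of
`ε m(ε) ^ (j + 1) ≤ ε n ^ (j + 1)` (`mul_pow_le_of_reciprocally_positive`).

The Hilbert space structure enters through Parseval's identity on the roots of unity
(`sum_norm_sq_dft`), which turns the uniform bound on the kernel into a square-sum bound for
`χ k • T ^ k (1 - T) x`. Since `∑ χ k T ^ (L - k) T ^ k (1 - T) = (∑ χ k) T ^ L (1 - T)`, the
Cauchy–Schwarz inequality then gives the bound for `T ^ L (1 - T)`
(`norm_pow_mul_le_of_norm_aeval_smul_le`).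
-/

/-! ### Parseval's identity and Fourier multipliers -/

/-- Parseval's identity for the discrete Fourier transform of a finite sequence of vectors. -/
theorem sum_norm_sq_dft {X : Type*} [NormedAddCommGroup X] [InnerProductSpace ℂ X]
    {N : ℕ} [NeZero N] {ζ : ℂ} (hζ : IsPrimitiveRoot ζ N) (a : ℕ → X) :
    ∑ l ∈ Finset.range N, ‖∑ k ∈ Finset.range N, (ζ ^ l) ^ k • a k‖ ^ 2 =
      N * ∑ k ∈ Finset.range N, ‖a k‖ ^ 2 := by
  have hnorm : ‖ζ‖ = 1 := hζ.norm'_eq_one (NeZero.ne N)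
  have hζ0 : ζ ≠ 0 := fun h => by simp [h] at hnorm
  have hconj : (starRingEnd ℂ) ζ = ζ⁻¹ := (Complex.inv_eq_conj hnorm).symm
  have horth : ∀ i ∈ Finset.range N, ∀ k ∈ Finset.range N,
      ∑ l ∈ Finset.range N, (starRingEnd ℂ) ((ζ ^ l) ^ i) * (ζ ^ l) ^ k =
        if k = i then (N : ℂ) else 0 := by
    intro i hi k hk
    have hterm : ∀ l, (starRingEnd ℂ) ((ζ ^ l) ^ i) * (ζ ^ l) ^ k = (ζ ^ k / ζ ^ i) ^ l := by
      intro l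
      rw [map_pow, map_pow, hconj, div_pow, div_eq_mul_inv, inv_pow, inv_pow, ← pow_mul, ← pow_mul,
        ← pow_mul, ← pow_mul, mul_comm, mul_comm l k, mul_comm l i]
    simp only [hterm]
    split_ifs with h
    · simp [h, hζ0]
    · refine geom_sum_eq ?_ N |>.trans ?_
      · rw [Ne, div_eq_one_iff_eq (pow_ne_zero _ hζ0)]
        exact fun he => h (hζ.pow_inj (Finset.mem_range.1 hk) (Finset.mem_range.1 hi) he)
      · rw [div_pow, ← pow_mul, ← pow_mul, mul_comm k, mul_comm i, pow_mul, pow_mul, hζ.pow_eq_one]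
        simp
  have hC : ((∑ l ∈ Finset.range N, ‖∑ k ∈ Finset.range N, (ζ ^ l) ^ k • a k‖ ^ 2 : ℝ) : ℂ) =
      ((N * ∑ k ∈ Finset.range N, ‖a k‖ ^ 2 : ℝ) : ℂ) := by
    push_cast
    calc ∑ l ∈ Finset.range N, ((‖∑ k ∈ Finset.range N, (ζ ^ l) ^ k • a k‖ : ℝ) : ℂ) ^ 2
        = ∑ l ∈ Finset.range N, ∑ i ∈ Finset.range N, ∑ k ∈ Finset.range N,
            (starRingEnd ℂ) ((ζ ^ l) ^ i) * (ζ ^ l) ^ k * inner ℂ (a i) (a k) := by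
          refine Finset.sum_congr rfl fun l _ => ?_
          have h := inner_self_eq_norm_sq_to_K (𝕜 := ℂ)
            (∑ k ∈ Finset.range N, (ζ ^ l) ^ k • a k)
          refine Eq.trans h.symm ?_
          rw [sum_inner]
          refine Finset.sum_congr rfl fun i _ => ?_
          rw [inner_sum]
          refine Finset.sum_congr rfl fun k _ => ?_
          rw [inner_smul_left, inner_smul_right, mul_assoc]
      _ = ∑ i ∈ Finset.range N, ∑ k ∈ Finset.range N,
            (∑ l ∈ Finset.range N, (starRingEnd ℂ) ((ζ ^ l) ^ i) * (ζ ^ l) ^ k) *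
              inner ℂ (a i) (a k) := by
          rw [Finset.sum_comm]
          refine Finset.sum_congr rfl fun i _ => ?_
          rw [Finset.sum_comm]
          simp only [Finset.sum_mul]
      _ = ∑ i ∈ Finset.range N, N * ((‖a i‖ : ℝ) : ℂ) ^ 2 := by
          refine Finset.sum_congr rfl fun i hi => ?_
          rw [Finset.sum_congr rfl fun k hk => by rw [horth i hi k hk]]
          simp only [ite_mul, zero_mul, Finset.sum_ite_eq', hi, if_true]
          rw [inner_self_eq_norm_sq_to_K]
          rfl
      _ = N * ∑ k ∈ Finset.range N, ((‖a k‖ : ℝ) : ℂ) ^ 2 := by rw [Finset.mul_sum]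
  exact_mod_cast hC

open Polynomial in
/-- A bound for `S p(z T)`, uniform over the unit circle, transfers to a bound for `T ^ L S`.
Multiplying `p` by `1 + X + ⋯ + X ^ (M - 1)` makes the multiplier `S p(z T)` act on the transform
of the truncated orbit `x, T x, …, T ^ (M - 1) x`, whose square norm is at most `M (K ‖x‖)²`. -/
theorem norm_pow_mul_le_of_norm_aeval_smul_le {H : Type*} [NormedAddCommGroup H]
    [InnerProductSpace ℂ H] {T S : H →L[ℂ] H} (hST : Commute S T) {K δ : ℝ}
    (hK : ∀ n : ℕ, ‖T ^ n‖ ≤ K) (p : ℂ[X]) {M L : ℕ}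
    (hdeg : (p * ∑ i ∈ Finset.range M, X ^ i).natDegree ≤ L) (hML : M ≤ L)
    (hp : ∀ z : ℂ, ‖z‖ = 1 → ‖S * aeval (z • T) p‖ ≤ δ) :
    ‖p.eval 1‖ * M * ‖T ^ L * S‖ ≤ K ^ 2 * δ * √((L + 1) * M) := by
  have hK0 : 0 ≤ K := (norm_nonneg _).trans (hK 0)
  have hδ0 : 0 ≤ δ := (norm_nonneg _).trans (hp 1 (by simp))
  set q := p * ∑ i ∈ Finset.range M, X ^ i with hq
  have hq1 : q.eval 1 = p.eval 1 * M := by simp [hq, eval_finsetSum]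
  have hdeg' : q.natDegree < L + 1 := by omega
  have hζ := Complex.isPrimitiveRoot_exp (L + 1) (Nat.succ_ne_zero L)
  set ζ := Complex.exp (2 * Real.pi * Complex.I / ((L + 1 : ℕ) : ℂ))
  have hζn : ‖ζ‖ = 1 := hζ.norm'_eq_one (Nat.succ_ne_zero L)
  suffices hx : ∀ x : H, ‖p.eval 1‖ * M * ‖(T ^ L * S) x‖ ≤
      K ^ 2 * δ * √((L + 1) * M) * ‖x‖ by
    have hop := ContinuousLinearMap.opNorm_le_bound ((p.eval 1 * M) • (T ^ L * S))
      (M := K ^ 2 * δ * √((L + 1) * M)) (by positivity) fun x => by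
        simpa [norm_smul, mul_assoc] using hx x
    simpa [norm_smul] using hop
  intro x
  -- The transform of `a` is the multiplier applied to the transform of the truncated orbit `b`
  -- below; since `q` has degree at most `L`, there is no aliasing among the `(L + 1)`-st roots of
  -- unity.
  set a : ℕ → H := fun k => q.coeff k • S ((T ^ k) x) with ha
  have htrans (z : ℂ) : ∑ k ∈ Finset.range (L + 1), z ^ k • a k =
      (S * aeval (z • T) p) (∑ i ∈ Finset.range M, z ^ i • (T ^ i) x) := by
    have h1 : (S * aeval (z • T) q) x = ∑ k ∈ Finset.range (L + 1), z ^ k • a k := by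
      rw [aeval_eq_sum_range' hdeg']
      simp only [ha, _root_.smul_pow, Finset.mul_sum, sum_apply, mul_smul_comm,
        smul_apply, smul_comm (z ^ _)]
      rfl
    rw [← h1, hq, map_mul]
    simp only [← mul_assoc, map_sum, map_pow, aeval_X, _root_.smul_pow, Finset.mul_sum, sum_apply,
      mul_smul_comm, smul_apply, map_smul]
    rfl
  have hpars : ∑ k ∈ Finset.range (L + 1), ‖a k‖ ^ 2 ≤ δ ^ 2 * (M * (K * ‖x‖) ^ 2) := by
    set b : ℕ → H := fun i => if i < M then (T ^ i) x else 0 with hb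
    have hbsum (f : ℕ → H → H) (hf : ∀ i, f i 0 = 0) :
        ∑ i ∈ Finset.range (L + 1), f i (b i) = ∑ i ∈ Finset.range M, f i ((T ^ i) x) := by
      refine (Finset.sum_subset (Finset.range_mono (by omega)) fun i _ hi => ?_).symm.trans
        (Finset.sum_congr rfl fun i hi => ?_)
      · have : ¬ i < M := by simpa using hi
        simp [hb, this, hf]
      · simp [hb, Finset.mem_range.1 hi]
    have hA := sum_norm_sq_dft hζ a
    have hB := sum_norm_sq_dft hζ b
    have hle : ∑ l ∈ Finset.range (L + 1), ‖∑ k ∈ Finset.range (L + 1), (ζ ^ l) ^ k • a k‖ ^ 2 ≤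
        δ ^ 2 * ∑ l ∈ Finset.range (L + 1),
          ‖∑ k ∈ Finset.range (L + 1), (ζ ^ l) ^ k • b k‖ ^ 2 := by
      rw [Finset.mul_sum]
      refine Finset.sum_le_sum fun l _ => ?_
      rw [htrans, hbsum (fun k y => (ζ ^ l) ^ k • y) (by simp), ← mul_pow]
      gcongr
      exact ContinuousLinearMap.le_of_opNorm_le _ (hp _ (by simp [hζn])) _
    rw [hA, hB] at hle
    have hbb : ∑ k ∈ Finset.range (L + 1), ‖b k‖ ^ 2 ≤ M * (K * ‖x‖) ^ 2 := by
      calc ∑ k ∈ Finset.range (L + 1), ‖b k‖ ^ 2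
          ≤ ∑ k ∈ Finset.range (L + 1), if k < M then (K * ‖x‖) ^ 2 else 0 := by
            refine Finset.sum_le_sum fun k _ => ?_
            simp only [hb]
            split_ifs
            · gcongr
              exact ContinuousLinearMap.le_of_opNorm_le _ (hK k) x
            · simp
        _ = ∑ k ∈ Finset.range M, (K * ‖x‖) ^ 2 := by
            rw [← Finset.sum_filter]
            congr 1
            ext k
            simp
            omega
        _ = M * (K * ‖x‖) ^ 2 := by simp
    have hN : (0 : ℝ) < (L + 1 : ℕ) := by positivity
    rw [mul_left_comm] at hle
    exact (le_of_mul_le_mul_left hle hN).trans (by gcongr)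
  have hsplit : (p.eval 1 * M) • (T ^ L * S) x =
      ∑ k ∈ Finset.range (L + 1), (T ^ (L - k)) (a k) := by
    rw [← hq1, eval_eq_sum_range' hdeg', Finset.sum_smul]
    refine Finset.sum_congr rfl fun k hk => ?_
    have hkL : k ≤ L := Nat.lt_succ_iff.1 (Finset.mem_range.1 hk)
    have hop : T ^ L * S = T ^ (L - k) * (S * T ^ k) := by
      rw [(hST.pow_right k).eq, ← mul_assoc, ← pow_add, Nat.sub_add_cancel hkL]
    simp [ha, hop]
  calc ‖p.eval 1‖ * M * ‖(T ^ L * S) x‖ = ‖(p.eval 1 * M) • (T ^ L * S) x‖ := by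
        simp [norm_smul]
    _ ≤ ∑ k ∈ Finset.range (L + 1), K * ‖a k‖ := by
        rw [hsplit]
        exact norm_sum_le_of_le _ fun k _ => ContinuousLinearMap.le_of_opNorm_le _ (hK _) _
    _ = K * ∑ k ∈ Finset.range (L + 1), ‖a k‖ := by rw [Finset.mul_sum]
    _ ≤ K * √((L + 1) * (δ ^ 2 * (M * (K * ‖x‖) ^ 2))) := by
        gcongr
        refine Real.le_sqrt_of_sq_le (sq_sum_le_card_mul_sum_sq.trans ?_)
        rw [Finset.card_range]
        push_cast
        gcongr
    _ = K ^ 2 * δ * √((L + 1) * M) * ‖x‖ := by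
        rw [show ((L : ℝ) + 1) * (δ ^ 2 * (M * (K * ‖x‖) ^ 2)) =
          ((L + 1) * M) * (δ * (K * ‖x‖)) ^ 2 by ring, Real.sqrt_mul (by positivity),
          Real.sqrt_sq (by positivity)]
        ring

/-! ### Reciprocally positive increase and the right-inverse -/

/-- If `m` grows locally at least like `θ ↦ θ ^ (-α)` towards `0` and `α (j + 1) ≥ 1`, then
`θ ↦ θ * m θ ^ (j + 1)` is decreasing up to a constant factor. -/
theorem mul_pow_le_of_reciprocally_positive {m : ℝ → ℝ}
    (hm_pos : ∀ ε ∈ Set.Ioc (0 : ℝ) Real.pi, 0 < m ε)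
    (hm_anti : AntitoneOn m (Set.Ioc (0 : ℝ) Real.pi))
    (hm_incr : HasReciprocallyPositiveIncrease m) :
    ∃ j : ℕ, ∃ C : ℝ, 0 ≤ C ∧ ∃ ε₀ ∈ Set.Ioc (0 : ℝ) Real.pi, ∀ ε ∈ Set.Ioc (0 : ℝ) ε₀,
      ∀ θ ∈ Set.Icc ε Real.pi, θ * m θ ^ (j + 1) ≤ C * (ε * m ε ^ (j + 1)) := by
  obtain ⟨c, ⟨hc0, hc1⟩, α, hα, ε₀, ⟨hε₀, hε₀π⟩, h⟩ := hm_incr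
  obtain ⟨j, hj⟩ := exists_nat_ge (1 / α)
  have hjα : 1 ≤ α * ((j + 1 : ℕ) : ℝ) := by
    rw [div_le_iff₀ hα] at hj
    push_cast
    nlinarith
  have hnear : ∀ ε ∈ Set.Ioc (0 : ℝ) ε₀, ∀ θ ∈ Set.Icc ε ε₀,
      θ * m θ ^ (j + 1) ≤ (c⁻¹) ^ (j + 1) * (ε * m ε ^ (j + 1)) := by
    rintro ε ⟨hε, hεε₀⟩ θ ⟨hεθ, hθ⟩
    have hθ0 : 0 < θ := hε.trans_le hεθ
    have hmθ : 0 < m θ := hm_pos θ ⟨hθ0, hθ.trans hε₀π⟩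
    have ht1 : 1 ≤ θ / ε := (one_le_div hε).2 hεθ
    have ht := h (θ / ε) ht1 θ ⟨hθ0, hθ⟩
    rw [inv_div, div_mul_cancel₀ _ hθ0.ne', le_div_iff₀ hmθ] at ht
    have hpow : θ / ε ≤ ((θ / ε) ^ α) ^ (j + 1) := by
      rw [← Real.rpow_natCast, ← Real.rpow_mul (by positivity)]
      exact Real.self_le_rpow_of_one_le ht1 hjα
    have hm' : (θ / ε) ^ α * m θ ≤ c⁻¹ * m ε := by
      rw [le_inv_mul_iff₀ hc0, ← mul_assoc]
      exact ht
    calc θ * m θ ^ (j + 1) = ε * (θ / ε * m θ ^ (j + 1)) := by field_simp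
      _ ≤ ε * (((θ / ε) ^ α) ^ (j + 1) * m θ ^ (j + 1)) := by gcongr
      _ = ε * ((θ / ε) ^ α * m θ) ^ (j + 1) := by rw [mul_pow]
      _ ≤ ε * (c⁻¹ * m ε) ^ (j + 1) := by gcongr
      _ = (c⁻¹) ^ (j + 1) * (ε * m ε ^ (j + 1)) := by ring
  have hone : 1 ≤ Real.pi / ε₀ := (one_le_div hε₀).2 hε₀π
  refine ⟨j, Real.pi / ε₀ * (c⁻¹) ^ (j + 1), by positivity, ε₀, ⟨hε₀, hε₀π⟩, ?_⟩
  rintro ε ⟨hε, hεε₀⟩ θ ⟨hεθ, hθπ⟩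
  have hmε : 0 < m ε := hm_pos ε ⟨hε, hεε₀.trans hε₀π⟩
  rcases le_total θ ε₀ with hθ | hθ
  · refine (hnear ε ⟨hε, hεε₀⟩ θ ⟨hεθ, hθ⟩).trans ?_
    rw [mul_assoc]
    exact le_mul_of_one_le_left (by positivity) hone
  · have hmθ : 0 < m θ := hm_pos θ ⟨hε₀.trans_le hθ, hθπ⟩
    calc θ * m θ ^ (j + 1) ≤ Real.pi * m ε₀ ^ (j + 1) := by
          gcongr
          exact hm_anti ⟨hε₀, hε₀π⟩ ⟨hε₀.trans_le hθ, hθπ⟩ hθ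
      _ = Real.pi / ε₀ * (ε₀ * m ε₀ ^ (j + 1)) := by field_simp
      _ ≤ Real.pi / ε₀ * ((c⁻¹) ^ (j + 1) * (ε * m ε ^ (j + 1))) := by
          exact mul_le_mul_of_nonneg_left (hnear ε ⟨hε, hεε₀⟩ ε₀ ⟨hεε₀, le_rfl⟩) (by positivity)
      _ = _ := by ring

/-- Reciprocally positive increase forces `m` to blow up at `0`. -/
theorem exists_pos_forall_le_of_le {m : ℝ → ℝ}
    (hm_pos : ∀ ε ∈ Set.Ioc (0 : ℝ) Real.pi, 0 < m ε)
    (hm_anti : AntitoneOn m (Set.Ioc (0 : ℝ) Real.pi))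
    (hm_incr : HasReciprocallyPositiveIncrease m) (s : ℝ) :
    ∃ δ > 0, ∀ ε ∈ Set.Ioc (0 : ℝ) Real.pi, m ε ≤ s → δ ≤ ε := by
  obtain ⟨c, ⟨hc0, hc1⟩, α, hα, ε₀, ⟨hε₀, hε₀π⟩, h⟩ := hm_incr
  have hm₀ := hm_pos ε₀ ⟨hε₀, hε₀π⟩
  obtain ⟨t, ht1, ht⟩ := ((Filter.eventually_ge_atTop (1 : ℝ)).and
    ((tendsto_rpow_atTop hα).eventually_gt_atTop (s / (c * m ε₀)))).exists
  have ht0 : 0 < t := one_pos.trans_le ht1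
  refine ⟨t⁻¹ * ε₀, by positivity, fun ε hε hs => ?_⟩
  by_contra! hlt
  have hδ : t⁻¹ * ε₀ ≤ Real.pi :=
    (mul_le_of_le_one_left hε₀.le (inv_le_one_of_one_le₀ ht1)).trans hε₀π
  have h1 := hm_anti hε ⟨by positivity, hδ⟩ hlt.le
  have h2 := h t ht1 ε₀ ⟨hε₀, le_rfl⟩
  rw [le_div_iff₀ hm₀] at h2
  rw [div_lt_iff₀ (by positivity)] at ht
  linarith [mul_comm (t ^ α) (c * m ε₀), mul_right_comm c (t ^ α) (m ε₀)]

/-- The infimum defining `rightInv m s` is positive because `m` blows up at `0`, and attained because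
`m` is continuous. -/
theorem rightInv_mem {m : ℝ → ℝ}
    (hm_pos : ∀ ε ∈ Set.Ioc (0 : ℝ) Real.pi, 0 < m ε)
    (hm_cont : ContinuousOn m (Set.Ioc (0 : ℝ) Real.pi))
    (hm_anti : AntitoneOn m (Set.Ioc (0 : ℝ) Real.pi))
    (hm_incr : HasReciprocallyPositiveIncrease m) {ε s : ℝ}
    (hε : ε ∈ Set.Ioc (0 : ℝ) Real.pi) (hs : m ε ≤ s) :
    rightInv m s ∈ Set.Ioc (0 : ℝ) ε ∧ m (rightInv m s) ≤ s := by
  obtain ⟨δ, hδ, hlb⟩ := exists_pos_forall_le_of_le hm_pos hm_anti hm_incr s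
  have hsub : Set.Icc δ Real.pi ⊆ Set.Ioc 0 Real.pi := fun x hx => ⟨hδ.trans_le hx.1, hx.2⟩
  have hS : {ε : ℝ | ε ∈ Set.Ioc (0 : ℝ) Real.pi ∧ m ε ≤ s} =
      Set.Icc δ Real.pi ∩ m ⁻¹' Set.Iic s := by
    ext x
    exact ⟨fun hx => ⟨⟨hlb x hx.1 hx.2, hx.1.2⟩, hx.2⟩, fun hx => ⟨hsub hx.1, hx.2⟩⟩
  have hbdd : BddBelow {ε : ℝ | ε ∈ Set.Ioc (0 : ℝ) Real.pi ∧ m ε ≤ s} :=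
    ⟨0, fun x hx => hx.1.1.le⟩
  have hclosed : IsClosed {ε : ℝ | ε ∈ Set.Ioc (0 : ℝ) Real.pi ∧ m ε ≤ s} := by
    rw [hS]
    exact (hm_cont.mono hsub).preimage_isClosed_of_isClosed isClosed_Icc isClosed_Iic
  have hmem := hclosed.csInf_mem ⟨ε, hε, hs⟩ hbdd
  exact ⟨⟨hmem.1.1, csInf_le hbdd ⟨hε, hs⟩⟩, hmem.2⟩

/-! ### Resolvent bounds and geometric sums -/

theorem norm_geom_sum_le {A : Type*} [SeminormedRing A] {a : A} {K : ℝ} (hK : ∀ n : ℕ, ‖a ^ n‖ ≤ K)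
    (M : ℕ) : ‖∑ i ∈ Finset.range M, a ^ i‖ ≤ M * K := by
  simpa using norm_sum_le_of_le (Finset.range M) fun i _ => hK i

/-- The norm of the resolvent is at least the inverse distance to the spectrum. -/
theorem one_le_mul_norm_resolvent {A : Type*} [NormedRing A] [NormedAlgebra ℂ A] [CompleteSpace A]
    {a : A} {μ ν : ℂ} (hμ : μ ∈ spectrum ℂ a) (hν : ν ∈ resolventSet ℂ a) :
    1 ≤ ‖ν - μ‖ * ‖resolvent a ν‖ := by
  by_contra! hlt
  refine hμ ?_
  have hunit : IsUnit (algebraMap ℂ A ν - a) := hν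
  have hfac : algebraMap ℂ A μ - a =
      (algebraMap ℂ A ν - a) * (1 - (ν - μ) • resolvent a ν) := by
    rw [mul_sub, mul_one, mul_smul_comm, resolvent, Ring.mul_inverse_cancel _ hunit, sub_smul,
      ← Algebra.algebraMap_eq_smul_one, ← Algebra.algebraMap_eq_smul_one]
    abel
  show IsUnit _
  rw [hfac]
  exact hunit.mul (isUnit_one_sub_of_norm_lt_one (by rwa [norm_smul]))

/-- The uniform kernel bound: for power-bounded `a`, the resolvent bounds `m` on the part
`|θ| ≥ ε` of the unit circle control `(1 - a) (∑_{i < M} (z a)^i) ^ (j + 1)` at every point `z` of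
the circle. -/
theorem norm_one_sub_mul_geom_sum_pow_le {A : Type*} [NormedRing A] [NormedAlgebra ℂ A] {a : A}
    {K : ℝ} (hK : ∀ n : ℕ, ‖a ^ n‖ ≤ K) {m : ℝ → ℝ} {ε C D : ℝ} (hε : 0 < ε) (hC : 0 ≤ C)
    {M j : ℕ} (hD : 1 ≤ D * (ε * M))
    (hset : ∀ θ : ℝ, ε ≤ |θ| → |θ| ≤ Real.pi →
      Complex.exp (θ * Complex.I) ∈ resolventSet ℂ a)
    (hres : ∀ θ : ℝ, ε ≤ |θ| → |θ| ≤ Real.pi →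
      ‖resolvent a (Complex.exp (θ * Complex.I))‖ ≤ m |θ|)
    (hm : ∀ θ ∈ Set.Icc ε Real.pi, θ * m θ ^ (j + 1) ≤ C * (ε * M ^ (j + 1)))
    {z : ℂ} (hz : ‖z‖ = 1) :
    ‖(1 - a) * (∑ i ∈ Finset.range M, (z • a) ^ i) ^ (j + 1)‖ ≤
      (2 * D * K ^ (j + 1) + K ^ (j + 1) + (2 * K) ^ (j + 1) * C) * ε * M ^ (j + 1) := by
  have hK0 : 0 ≤ K := (norm_nonneg _).trans (hK 0)
  have hone : ‖(1 : A)‖ ≤ K := by simpa using hK 0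
  have hKz : ∀ n : ℕ, ‖(z • a) ^ n‖ ≤ K := fun n => by
    simpa [smul_pow, norm_smul, hz] using hK n
  set B := ∑ i ∈ Finset.range M, (z • a) ^ i with hB
  have hBM : ‖B‖ ≤ M * K := norm_geom_sum_le hKz M
  have htel : (1 - z • a) * B = 1 - (z • a) ^ M := mul_neg_geom_sum _ _
  have htel_norm : ‖1 - (z • a) ^ M‖ ≤ 2 * K := by
    linarith [norm_sub_le 1 ((z • a) ^ M), hKz M]
  have hpow : ‖B ^ (j + 1)‖ ≤ ‖B‖ ^ (j + 1) := norm_pow_le' B (Nat.succ_pos j)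
  -- The resolvent point is `z⁻¹ = exp (i θ)`, whence the sign.
  set θ := -Complex.arg z with hθ
  have hθπ : |θ| ≤ Real.pi := by simpa [hθ] using Complex.abs_arg_le_pi z
  have hzexp : z = Complex.exp (Complex.I * (-θ : ℝ)) := by
    have := Complex.norm_mul_exp_arg_mul_I z
    rw [hz, Complex.ofReal_one, one_mul] at this
    rw [hθ, neg_neg, mul_comm, this]
  have hzθ : ‖1 - z‖ ≤ |θ| := by
    rw [norm_sub_rev, hzexp]
    simpa using Real.norm_exp_I_mul_ofReal_sub_one_le (x := -θ)
  have h_scalar : ‖1 - z‖ * ‖B ^ (j + 1)‖ ≤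
      (K ^ (j + 1) + (2 * K) ^ (j + 1) * C) * ε * M ^ (j + 1) := by
    have hterm₁ : 0 ≤ K ^ (j + 1) * ε * (M : ℝ) ^ (j + 1) := by positivity
    have hterm₂ : 0 ≤ (2 * K) ^ (j + 1) * C * ε * (M : ℝ) ^ (j + 1) := by positivity
    rcases le_total |θ| ε with h | h
    · calc ‖1 - z‖ * ‖B ^ (j + 1)‖ ≤ ε * (M * K) ^ (j + 1) :=
            mul_le_mul (hzθ.trans h) (hpow.trans (by gcongr)) (norm_nonneg _) hε.le
        _ = K ^ (j + 1) * ε * (M : ℝ) ^ (j + 1) := by ring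
        _ ≤ _ := by linarith
    · have hinv : z * Complex.exp (θ * Complex.I) = 1 := by
        rw [hzexp, ← Complex.exp_add]
        simp [mul_comm]
      have hfac : 1 - z • a =
          z • (algebraMap ℂ A (Complex.exp (θ * Complex.I)) - a) := by
        rw [smul_sub, Algebra.algebraMap_eq_smul_one, smul_smul, hinv, one_smul]
      have hBres : z • B = resolvent a (Complex.exp (θ * Complex.I)) * (1 - (z • a) ^ M) := by
        rw [← htel, hfac, smul_mul_assoc, mul_smul_comm, ← mul_assoc, resolvent,
          Ring.inverse_mul_cancel _ (hset θ h hθπ), one_mul]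
      have hBθ : ‖B‖ ≤ m |θ| * (2 * K) := by
        calc ‖B‖ = ‖z • B‖ := by rw [norm_smul, hz, one_mul]
          _ ≤ _ := by
            rw [hBres]
            exact norm_mul_le_of_le (hres θ h hθπ) htel_norm
      calc ‖1 - z‖ * ‖B ^ (j + 1)‖ ≤ |θ| * (m |θ| * (2 * K)) ^ (j + 1) :=
            mul_le_mul hzθ (hpow.trans (by gcongr)) (norm_nonneg _) (abs_nonneg _)
        _ = (2 * K) ^ (j + 1) * (|θ| * m |θ| ^ (j + 1)) := by ring
        _ ≤ (2 * K) ^ (j + 1) * (C * (ε * M ^ (j + 1))) := by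
            exact mul_le_mul_of_nonneg_left (hm _ ⟨h, hθπ⟩) (by positivity)
        _ = (2 * K) ^ (j + 1) * C * ε * (M : ℝ) ^ (j + 1) := by ring
        _ ≤ _ := by linarith
  have h_tel : ‖(1 - (z • a) ^ M) * B ^ j‖ ≤ 2 * D * K ^ (j + 1) * ε * M ^ (j + 1) := by
    have h1 : ‖(1 - (z • a) ^ M) * B ^ j‖ ≤ 2 * K * (M * K) ^ j := by
      rcases Nat.eq_zero_or_pos j with rfl | hj
      · simpa using htel_norm
      · exact norm_mul_le_of_le htel_norm ((norm_pow_le' B hj).trans (by gcongr))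
    calc _ ≤ _ := h1
      _ ≤ 2 * K * (M * K) ^ j * (D * (ε * M)) := le_mul_of_one_le_right (by positivity) hD
      _ = _ := by ring
  have hsplit : z • ((1 - a) * B ^ (j + 1)) =
      (1 - (z • a) ^ M) * B ^ j - (1 - z) • B ^ (j + 1) := by
    rw [← htel, mul_assoc, ← pow_succ', ← smul_mul_assoc, ← smul_one_mul (1 - z), ← sub_mul]
    congr 1
    rw [smul_sub, sub_smul, one_smul]
    abel
  calc ‖(1 - a) * B ^ (j + 1)‖ = ‖z • ((1 - a) * B ^ (j + 1))‖ := by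
        rw [norm_smul, hz, one_mul]
    _ ≤ ‖(1 - (z • a) ^ M) * B ^ j‖ + ‖1 - z‖ * ‖B ^ (j + 1)‖ := by
        rw [hsplit, ← norm_smul]
        exact norm_sub_le _ _
    _ ≤ _ := by linarith

/-! ### The decay rate -/

theorem theorem2p2 {X : Type*} [NormedAddCommGroup X] [InnerProductSpace ℂ X] [CompleteSpace X]
    (T : X →L[ℂ] X) (hT : IsPowerBounded T)
    (hσ : spectrum ℂ T ∩ Metric.sphere (0 : ℂ) 1 = {1})
    (m : ℝ → ℝ) (hm_pos : ∀ ε ∈ Set.Ioc (0 : ℝ) Real.pi, 0 < m ε)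
    (hm_cont : ContinuousOn m (Set.Ioc (0 : ℝ) Real.pi))
    (hm_anti : AntitoneOn m (Set.Ioc (0 : ℝ) Real.pi))
    (hm_incr : HasReciprocallyPositiveIncrease m)
    (hres : ∀ θ : ℝ, 0 < |θ| → |θ| ≤ Real.pi →
      ‖resolvent T (Complex.exp (θ * Complex.I))‖ ≤ m |θ|) :
    (fun n : ℕ => ‖T ^ n * (1 - T)‖) =O[Filter.atTop] (fun n : ℕ => rightInv m (n : ℝ)) := by
  obtain ⟨K, hK⟩ := hT
  have hK0 : 0 ≤ K := (norm_nonneg _).trans (hK 0)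
  have hset : ∀ θ : ℝ, 0 < |θ| → |θ| ≤ Real.pi →
      Complex.exp (θ * Complex.I) ∈ resolventSet ℂ T := by
    intro θ h0 hπ
    by_contra hmem
    have h1 : Complex.exp (θ * Complex.I) ∈ spectrum ℂ T ∩ Metric.sphere (0 : ℂ) 1 :=
      ⟨hmem, by simp [Complex.norm_exp_ofReal_mul_I]⟩
    rw [hσ, Set.mem_singleton_iff, Complex.exp_eq_one_iff] at h1
    obtain ⟨n, hn⟩ := h1
    have hθ : θ = n * (2 * Real.pi) := by
      have h2 : (θ : ℂ) = (n * (2 * Real.pi) : ℝ) := by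
        apply mul_right_cancel₀ Complex.I_ne_zero
        rw [hn]
        push_cast
        ring
      exact_mod_cast h2
    have hn0 : n ≠ 0 := by
      rintro rfl
      simp [hθ] at h0
    have hn1 : (1 : ℝ) ≤ |(n : ℝ)| := by exact_mod_cast Int.one_le_abs hn0
    rw [hθ, abs_mul, abs_of_pos Real.two_pi_pos] at hπ
    nlinarith [Real.pi_pos]
  have h1σ : (1 : ℂ) ∈ spectrum ℂ T := by
    have : (1 : ℂ) ∈ spectrum ℂ T ∩ Metric.sphere (0 : ℂ) 1 := by rw [hσ]; rfl
    exact this.1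
  obtain ⟨j, C, hC, ε₀, hε₀, hmC⟩ := mul_pow_le_of_reciprocally_positive hm_pos hm_anti hm_incr
  -- `d * M` bounds the degree of the `(j + 2)`-nd power of `∑_{i < M} X^i`.
  set d : ℕ := j + 2 with hd
  have hd0 : (0 : ℝ) < d := by positivity
  set G : ℝ := 2 * (2 * d) * K ^ (j + 1) + K ^ (j + 1) +
    (2 * K) ^ (j + 1) * (C * (2 * d) ^ (j + 1)) with hG
  have hG0 : 0 ≤ G := by positivity
  refine Asymptotics.IsBigO.of_bound (K * (K ^ 2 * G * √(d + 1))) ?_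
  filter_upwards [Filter.eventually_ge_atTop ⌈m ε₀⌉₊, Filter.eventually_ge_atTop d] with n hn hdn
  obtain ⟨hε, hmε⟩ := rightInv_mem hm_pos hm_cont hm_anti hm_incr hε₀ (Nat.ceil_le.1 hn)
  set ε := rightInv m (n : ℝ)
  have hεπ : ε ∈ Set.Ioc (0 : ℝ) Real.pi := ⟨hε.1, hε.2.trans hε₀.2⟩
  have hmε0 := hm_pos ε hεπ
  set M : ℕ := n / d with hM
  have hM1 : 1 ≤ M := (Nat.one_le_div_iff (by omega)).2 hdn
  have hM0 : (0 : ℝ) < M := by exact_mod_cast hM1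
  have hMn : d * M ≤ n := Nat.mul_div_le n d
  have hnM : (n : ℝ) ≤ 2 * d * M := by
    have h1 : n < d * M + d := by
      rw [hM, ← Nat.mul_succ]
      exact Nat.lt_mul_div_succ n (by omega)
    have h2 : d ≤ d * M := Nat.le_mul_of_pos_right d hM1
    have h3 : n ≤ 2 * d * M := by rw [mul_assoc]; omega
    exact_mod_cast h3
  -- Since `1 ∈ σ(T)`, the resolvent bound at `exp (i ε)` gives `1 ≤ ε * m ε ≤ ε * n`.
  have hεM : 1 ≤ 2 * d * (ε * M) := by
    have habs : |ε| = ε := abs_of_pos hε.1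
    have h1 := one_le_mul_norm_resolvent h1σ (hset ε (by rw [habs]; exact hε.1)
      (by rw [habs]; exact hεπ.2))
    have h2 : ‖Complex.exp (ε * Complex.I) - 1‖ ≤ ε := by
      simpa [mul_comm, abs_of_pos hε.1] using Real.norm_exp_I_mul_ofReal_sub_one_le (x := ε)
    have h3 := hres ε (by rw [habs]; exact hε.1) (by rw [habs]; exact hεπ.2)
    rw [habs] at h3
    calc (1 : ℝ) ≤ ε * m ε := h1.trans (mul_le_mul h2 h3 (norm_nonneg _) hε.1.le)
      _ ≤ ε * (2 * d * M) := by
          have := hε.1.le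
          gcongr
          exact hmε.trans hnM
      _ = _ := by ring
  have hkernel (z : ℂ) (hz : ‖z‖ = 1) :
      ‖(1 - T) * (∑ i ∈ Finset.range M, (z • T) ^ i) ^ (j + 1)‖ ≤ G * ε * M ^ (j + 1) := by
    refine norm_one_sub_mul_geom_sum_pow_le hK hε.1 (by positivity) hεM
      (fun θ h => hset θ (hε.1.trans_le h)) (fun θ h => hres θ (hε.1.trans_le h)) ?_ hz
    intro θ hθ
    have hε' := hε.1.le
    calc θ * m θ ^ (j + 1) ≤ C * (ε * m ε ^ (j + 1)) := hmC ε hε θ hθ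
      _ ≤ C * (ε * (2 * d * M) ^ (j + 1)) := by
          gcongr
          exact hmε.trans hnM
      _ = _ := by ring
  have hmain := norm_pow_mul_le_of_norm_aeval_smul_le (S := 1 - T) (L := d * M)
    ((Commute.one_left T).sub_left (Commute.refl T)) hK
    ((∑ i ∈ Finset.range M, Polynomial.X ^ i) ^ (j + 1)) (M := M) ?_
    (Nat.le_mul_of_pos_left M (by omega)) fun z hz => by
      simpa using hkernel z hz
  · have heval : ‖((∑ i ∈ Finset.range M, Polynomial.X ^ i) ^ (j + 1) :
        Polynomial ℂ).eval 1‖ = (M : ℝ) ^ (j + 1) := by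
      simp [Polynomial.eval_finsetSum]
    rw [heval] at hmain
    have hsqrt : √(((d * M : ℕ) + 1) * (M : ℝ)) ≤ √(d + 1) * M := by
      rw [← Real.sqrt_sq hM0.le, ← Real.sqrt_mul (by positivity), Real.sqrt_sq hM0.le]
      apply Real.sqrt_le_sqrt
      have : (1 : ℝ) ≤ M := by exact_mod_cast hM1
      push_cast
      nlinarith
    have hL : ‖T ^ (d * M) * (1 - T)‖ ≤ K ^ 2 * G * √(d + 1) * ε := by
      have hε' := hε.1.le
      refine le_of_mul_le_mul_left (a := (M : ℝ) ^ (j + 1) * M) ?_ (by positivity)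
      calc _ ≤ _ := hmain
        _ ≤ K ^ 2 * (G * ε * M ^ (j + 1)) * (√(d + 1) * M) := by gcongr
        _ = _ := by ring
    rw [norm_norm, Real.norm_of_nonneg hε.1.le]
    calc ‖T ^ n * (1 - T)‖ = ‖T ^ (n - d * M) * (T ^ (d * M) * (1 - T))‖ := by
          rw [← mul_assoc, ← pow_add, Nat.sub_add_cancel hMn]
      _ ≤ K * (K ^ 2 * G * √(d + 1) * ε) := norm_mul_le_of_le (hK _) hL
      _ = _ := by ring
  · have hB : (∑ i ∈ Finset.range M, Polynomial.X ^ i : Polynomial ℂ).natDegree ≤ M :=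
      Polynomial.natDegree_sum_le_of_forall_le _ _ fun i hi => by
        simpa using (Finset.mem_range.1 hi).le
    rw [← pow_succ]
    exact Polynomial.natDegree_pow_le_of_le _ hB
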